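/- Let $K$ be a field. A $K$-algebra is a $K$-vector space $A$ with a bilinear product $\circ$ (not assumed associative or unital). It is called (right) Novikov if $$a\circ(b\circ c)-(a\circ b)\circ c=a\circ(c\circ b)-(a\circ c)\circ b\quad\text{and}\quad a\circ(b\circ c)=b\circ(a\circ c)$$ for all $a,b,c\in A$. Let $A^+$ be the vector space $A$ with the commutative product $\{a,b\}=a\circ b+b\circ a$. An algebra $(B,\star)$ is called Tortken if $$(a\star b)\star(c\star d)-(a\star d)\star(c\star b)=(a,b,c)\star d-(a,d,c)\star b$$ for all $a,b,c,d\in B$, where $(a,b,c)=a\star(b\star c)-(a\star b)\star c$. Non-associative polynomials are the elements of the free non-associative $K$-algebra without unit on variables $t_0,t_1,t_2,\dots$; such a polynomial is an identity on an algebra if it vanishes under all substitutions of elements of the algebra for the variables. A polynomial follows from a set $S$ of polynomials if it lies in the smallest two-sided ideal of the free algebra that contains all substitution instances of the elements of $S$. Commutativity is the polynomial $t_0t_1-t_1t_0$, and the Tortken polynomial is $$(t_0t_1)(t_2t_3)-(t_0t_3)(t_2t_1)-\bigl(t_0(t_1t_2)-(t_0t_1)t_2\bigr)t_3+\bigl(t_0(t_3t_2)-(t_0t_3)t_2\bigr)t_1.$$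 **Theorem.** (1) If $A$ is a Novikov algebra over a field $K$ of any characteristic, then $A^+$ is a Tortken algebra. (2) If $\operatorname{char}K\neq 2$, then the Tortken identity is the Jordan identity of the class of Novikov algebras over $K$, that is, it is the identity of minimal degree of the algebras $A^+$ ($A$ Novikov) that does not follow from commutativity. Precisely: - (a) the Tortken polynomial does not follow from commutativity; - (b) a polynomial of degree at most $3$ is an identity on $A^+$ for every Novikov $K$-algebra $A$ if and only if it follows from commutativity; - (c) a multilinear polynomial of degree $4$ in $t_0,t_1,t_2,t_3$ is an identity on $A^+$ for every Novikov $K$-algebra $A$ if and only if it follows from commutativity and the Tortken polynomial. -/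

import Mathlib

open FreeNonUnitalNonAssocAlgebra

universe u v

/-- The (right) Novikov identities for a bilinear product `a ∘ b = a * b`:
right-symmetry `(a, b, c) = (a, c, b)`, where `(a, b, c) = a ∘ (b ∘ c) - (a ∘ b) ∘ c`,
and left-commutativity `a ∘ (b ∘ c) = b ∘ (a ∘ c)`. -/
structure IsNovikov (A : Type v) [NonUnitalNonAssocRing A] : Prop where
  right_symm : ∀ a b c : A,
    a * (b * c) - (a * b) * c = a * (c * b) - (a * c) * b
  left_comm : ∀ a b c : A, a * (b * c) = b * (a * c)

/-- The (right) Tortken identity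
`(ab)(cd) - (ad)(cb) = (a,b,c)d - (a,d,c)b`, where `(a,b,c) = a(bc) - (ab)c`. -/
def IsTortken (A : Type v) [NonUnitalNonAssocRing A] : Prop :=
  ∀ a b c d : A,
    (a * b) * (c * d) - (a * d) * (c * b) =
      (a * (b * c) - (a * b) * c) * d - (a * (d * c) - (a * d) * c) * b

/-- The underlying vector space of the Jordan algebra `A⁺` of `A`. -/
def PlusAlg (A : Type v) : Type v := A

namespace PlusAlg

variable {A : Type v}

/-- The identity map `A → A⁺`. -/
def mk : A → PlusAlg A := fun a => a

/-- The identity map `A⁺ → A`. -/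
def val : PlusAlg A → A := fun a => a

instance [NonUnitalNonAssocRing A] : AddCommGroup (PlusAlg A) :=
  inferInstanceAs (AddCommGroup A)

/-- The Jordan product `{a, b} = a ∘ b + b ∘ a` on `A⁺`. -/
instance [NonUnitalNonAssocRing A] : Mul (PlusAlg A) :=
  ⟨fun a b => mk (a.val * b.val + b.val * a.val)⟩

theorem mul_def [NonUnitalNonAssocRing A] (a b : A) : mk a * mk b = mk (a * b + b * a) := rfl

instance [NonUnitalNonAssocRing A] : NonUnitalNonAssocRing (PlusAlg A) :=
  { (inferInstance : AddCommGroup (PlusAlg A)), (inferInstance : Mul (PlusAlg A)) with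
    left_distrib := fun (a b c : A) => by
      change a * (b + c) + (b + c) * a = (a * b + b * a) + (a * c + c * a)
      rw [mul_add, add_mul]; abel
    right_distrib := fun (a b c : A) => by
      change (a + b) * c + c * (a + b) = (a * c + c * a) + (b * c + c * b)
      rw [mul_add, add_mul]; abel
    zero_mul := fun (a : A) => by
      change (0 : A) * a + a * 0 = 0
      simp
    mul_zero := fun (a : A) => by
      change a * (0 : A) + 0 * a = 0
      simp }

variable {K : Type u} [Field K] [NonUnitalNonAssocRing A] [Module K A]

instance : Module K (PlusAlg A) := inferInstanceAs (Module K A)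

instance [IsScalarTower K A A] [SMulCommClass K A A] :
    IsScalarTower K (PlusAlg A) (PlusAlg A) :=
  ⟨fun (r : K) (a b : A) => by
    change (r • a) * b + b * (r • a) = r • (a * b + b * a)
    rw [smul_mul_assoc, mul_smul_comm, smul_add]⟩

instance [IsScalarTower K A A] [SMulCommClass K A A] :
    SMulCommClass K (PlusAlg A) (PlusAlg A) :=
  ⟨fun (r : K) (a b : A) => by
    change r • (a * b + b * a) = a * (r • b) + (r • b) * a
    rw [smul_mul_assoc, mul_smul_comm, smul_add]⟩

end PlusAlg

section Identities

variable (K : Type u) [Field K]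

/-- Non-associative polynomials over `K` (without constant term) in the variables
`t_0, t_1, t_2, …`: linear combinations of nonempty bracketed words. -/
abbrev NAPoly : Type u := FreeNonUnitalNonAssocAlgebra K ℕ

/-- The polynomial `f` is an identity on the `K`-algebra `A`: it vanishes under every
substitution `t_i := a i` of elements of `A`. -/
def IsIdentityOn (f : NAPoly K) (A : Type v) [NonUnitalNonAssocRing A] [Module K A]
    [IsScalarTower K A A] [SMulCommClass K A A] : Prop :=
  ∀ a : ℕ → A, lift K a f = 0

/-- `f` is an identity of the class `𝒩⁺`: it is an identity on `A⁺` for every Novikov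
algebra `A` over `K`. -/
def IsNovikovJordanIdentity (f : NAPoly K) : Prop :=
  ∀ (A : Type u) [NonUnitalNonAssocRing A] [Module K A] [IsScalarTower K A A]
    [SMulCommClass K A A], IsNovikov A → IsIdentityOn K f (PlusAlg A)

/-- `f` follows from the identities `S`: it lies in the T-ideal generated by `S`, the smallest
two-sided ideal of the free non-associative algebra that contains all substitution instances
of the elements of `S`. -/
inductive FollowsFrom (S : Set (NAPoly K)) : NAPoly K → Prop
  | subst (g : NAPoly K) (hg : g ∈ S) (a : ℕ → NAPoly K) : FollowsFrom S (lift K a g)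
  | zero : FollowsFrom S 0
  | add (f g : NAPoly K) : FollowsFrom S f → FollowsFrom S g → FollowsFrom S (f + g)
  | smul (r : K) (f : NAPoly K) : FollowsFrom S f → FollowsFrom S (r • f)
  | mul_left (h f : NAPoly K) : FollowsFrom S f → FollowsFrom S (h * f)
  | mul_right (h f : NAPoly K) : FollowsFrom S f → FollowsFrom S (f * h)

/-- The commutativity polynomial `t_0 t_1 - t_1 t_0`. -/
noncomputable def comPoly : NAPoly K := of K 0 * of K 1 - of K 1 * of K 0

/-- The Tortken polynomial
`(ab)(cd) - (ad)(cb) - (a(bc) - (ab)c)d + (a(dc) - (ad)c)b`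
in `a = t_0`, `b = t_1`, `c = t_2`, `d = t_3`. -/
noncomputable def tortkenPoly : NAPoly K :=
  (of K 0 * of K 1) * (of K 2 * of K 3) - (of K 0 * of K 3) * (of K 2 * of K 1)
    - (of K 0 * (of K 1 * of K 2) - (of K 0 * of K 1) * of K 2) * of K 3
    + (of K 0 * (of K 3 * of K 2) - (of K 0 * of K 3) * of K 2) * of K 1

/-- The multiset of (indices of) variables that occur in a bracketed word. -/
def letters : FreeMagma ℕ → Multiset ℕ
  | .of i => {i}
  | .mul x y => letters x + letters y

variable {K}

/-- `f` has degree at most `n`. -/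
def DegreeLE (n : ℕ) (f : NAPoly K) : Prop :=
  ∀ w ∈ f.coeff.support, w.length ≤ n

/-- `f` is multilinear of degree `n`: every one of its monomials contains each of
`t_0, …, t_{n-1}` exactly once and no other variable. -/
def IsMultilinearPoly (n : ℕ) (f : NAPoly K) : Prop :=
  ∀ w ∈ f.coeff.support, letters w = Multiset.range n

/-- The Tortken polynomial is an identity on `A` exactly if `A` is a Tortken algebra. -/
theorem isIdentityOn_tortkenPoly_iff (A : Type v) [NonUnitalNonAssocRing A] [Module K A]
    [IsScalarTower K A A] [SMulCommClass K A A] :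
    IsIdentityOn K (tortkenPoly K) A ↔ IsTortken A := by
  have key : ∀ a : ℕ → A, lift K a (tortkenPoly K) =
      (a 0 * a 1) * (a 2 * a 3) - (a 0 * a 3) * (a 2 * a 1)
        - (a 0 * (a 1 * a 2) - (a 0 * a 1) * a 2) * a 3
        + (a 0 * (a 3 * a 2) - (a 0 * a 3) * a 2) * a 1 := by
    intro a
    simp only [tortkenPoly, map_add, map_sub, map_mul, lift_of_apply]
  constructor
  · intro h a b c d
    have := h (fun n => match n with | 0 => a | 1 => b | 2 => c | _ => d)
    rw [key] at this
    rw [← sub_eq_zero, ← this]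
    abel
  · intro h a
    rw [key]
    have := sub_eq_zero.mpr (h (a 0) (a 1) (a 2) (a 3))
    rw [← this]
    abel

end Identities

/-! Part (1) is a computation: the Tortken identity in `A⁺` is an integer combination of degree-four
consequences of the Novikov identities, so the characteristic plays no role. Commutativity alone
does not give it: the Jordan algebra of the 2 × 2 matrices is a counterexample when 2 ≠ 0.

For the converse, an identity f is tested on a single Novikov algebra, the differential polynomials
with a ∘ b = D(a) b. There {a, b} = D(ab), so a bracketed word becomes an iterated derivative of
products. Let B be the relatively free commutative algebra (in degree four: commutative Tortken
algebra). The linear maps `recover₃` and `recover₄` from differential polynomials to B send the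
value of each word w of the relevant degree to 2w and 8w. Since f has value 0, the class of f in B
is killed by 2 or 8, hence is 0, and f follows from the identities that define B.

Such a map is prescribed on monomials, so the prescribed values must be symmetric in factors with
the same order of derivation. In degree four they are built from `tortkenY` and `tortkenZ`, the
elements of B that stand for 4p'q'rs and 4p''qrs. The Tortken identity gives them the symmetries of
these monomials, and `four_smul_mul_mul` and `four_smul_mul_mul_mul` recover the words from them. -/

theorem PlusAlg.mul_comm {A : Type v} [NonUnitalNonAssocRing A] (a b : PlusAlg A) :
    a * b = b * a :=
  add_comm (a.val * b.val) (b.val * a.val)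

/-- The Jordan algebra of a Novikov algebra is Tortken, in any characteristic. -/
theorem IsNovikov.isTortken_plusAlg {A : Type v} [NonUnitalNonAssocRing A] (hA : IsNovikov A) :
    IsTortken (PlusAlg A) := by
  intro (a : A) (b : A) (c : A) (d : A)
  have hRS : ∀ a b c : A, a * (b * c) - (a * b) * c - (a * (c * b) - (a * c) * b) = 0 :=
    fun a b c => sub_eq_zero.2 (hA.right_symm a b c)
  have hLC : ∀ a b c : A, a * (b * c) - b * (a * c) = 0 :=
    fun a b c => sub_eq_zero.2 (hA.left_comm a b c)
  -- Multiplying the identities by a further element on either side gives degree-four consequences;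
  -- the others come from substituting a product for a variable. After expansion all bracketed words
  -- are atoms for `module`.
  have hRSr : ∀ a b c d : A,
      (a * (b * c)) * d - ((a * b) * c) * d - ((a * (c * b)) * d - ((a * c) * b) * d) = 0 := by
    intro a b c d
    simpa only [sub_mul, zero_mul] using congrArg (· * d) (hRS a b c)
  have hRSl : ∀ d a b c : A,
      d * (a * (b * c)) - d * ((a * b) * c) - (d * (a * (c * b)) - d * ((a * c) * b)) = 0 := by
    intro d a b c
    simpa only [mul_sub, mul_zero] using congrArg (d * ·) (hRS a b c)
  have hLCr : ∀ a b c d : A, (a * (b * c)) * d - (b * (a * c)) * d = 0 := by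
    intro a b c d
    simpa only [sub_mul, zero_mul] using congrArg (· * d) (hLC a b c)
  have hLCl : ∀ d a b c : A, d * (a * (b * c)) - d * (b * (a * c)) = 0 := by
    intro d a b c
    simpa only [mul_sub, mul_zero] using congrArg (d * ·) (hLC a b c)
  have key :
      (a * b + b * a) * (c * d + d * c) + (c * d + d * c) * (a * b + b * a)
        - ((a * d + d * a) * (c * b + b * c) + (c * b + b * c) * (a * d + d * a))
      = ((a * (b * c + c * b) + (b * c + c * b) * a
          - ((a * b + b * a) * c + c * (a * b + b * a))) * d
        + d * (a * (b * c + c * b) + (b * c + c * b) * a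
          - ((a * b + b * a) * c + c * (a * b + b * a))))
      - ((a * (d * c + c * d) + (d * c + c * d) * a
          - ((a * d + d * a) * c + c * (a * d + d * a))) * b
        + b * (a * (d * c + c * d) + (d * c + c * d) * a
          - ((a * d + d * a) * c + c * (a * d + d * a)))) := by
    simp only [mul_add, add_mul, mul_sub, sub_mul]
    linear_combination (norm := module)
      hRSr c b d a + hRSl a c b d - hRSr a c d b - hRSl b a c d + hRSr d a c b + hRSl b d a c
      - hRSr a b c d - hRSl d a b c - hRSr b a c d - hRSl d b a c + hRS d (a * b) c
      - hRS (a * c) b d - hRS b (a * c) d + hRS d (a * c) b - hRS b (a * d) c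
      - (2 : ℤ) • hRS c (a * d) b + hRS d (b * a) c + hRS a (b * d) c + hRS (c * b) a d
      + hRS a (c * b) d - hRS d (c * b) a - hRS (c * d) a b + hRS a (c * d) b + hRS b (c * d) a
      - hRS b (d * a) c - hRS a (d * b) c + hLCr b c d a + hLCr c d b a + (3 : ℤ) • hLCr a c d b
      + (4 : ℤ) • hLCl b a c d - hLCr c d a b - (2 : ℤ) • hLCl b c d a + hLCr a b d c
      - hLCr a d b c - hLCr b d a c - (2 : ℤ) • hLCl d a c b - hLCr b c a d
      - (2 : ℤ) • hLCl d b c a + hLC (a * b) d c - (2 : ℤ) • hLC b d (a * c) - hLC (a * d) b c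
      - (2 : ℤ) • hLC (a * d) c b + (2 : ℤ) • hLC b c (a * d) + hLC (b * a) d c + hLC (b * d) a c
      - hLC b d (c * a) + hLC a d (c * b) + (2 : ℤ) • hLC (c * d) a b + hLC a b (c * d)
      - hLC (d * a) b c - hLC (d * b) a c - hLCr a c b d
  exact key

/-! ### Consequences of identities, and independence of Tortken from commutativity -/

section Soundness

variable {K : Type u} [Field K]

theorem isIdentityOn_comPoly_iff (A : Type v) [NonUnitalNonAssocRing A] [Module K A]
    [IsScalarTower K A A] [SMulCommClass K A A] :
    IsIdentityOn K (comPoly K) A ↔ ∀ a b : A, a * b = b * a := by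
  have key : ∀ a : ℕ → A, lift K a (comPoly K) = a 0 * a 1 - a 1 * a 0 := by
    intro a
    simp only [comPoly, map_sub, map_mul, lift_of_apply]
  constructor
  · intro h a b
    have := h (fun n => if n = 0 then a else b)
    rw [key] at this
    simpa [sub_eq_zero] using this
  · intro h a
    rw [key, h, sub_self]

theorem lift_lift_apply {A : Type v} [NonUnitalNonAssocRing A] [Module K A]
    [IsScalarTower K A A] [SMulCommClass K A A] (a : ℕ → A) (s : ℕ → NAPoly K) (f : NAPoly K) :
    lift K a (lift K s f) = lift K (fun i => lift K a (s i)) f := by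
  have : (lift K a).comp (lift K s) = lift K (fun i => lift K a (s i)) :=
    hom_ext K fun x => by simp
  exact DFunLike.congr_fun this f

/-- Identities of an algebra are closed under consequences. -/
theorem FollowsFrom.isIdentityOn {S : Set (NAPoly K)} {f : NAPoly K} (hf : FollowsFrom K S f)
    {A : Type v} [NonUnitalNonAssocRing A] [Module K A] [IsScalarTower K A A]
    [SMulCommClass K A A] (hS : ∀ g ∈ S, IsIdentityOn K g A) : IsIdentityOn K f A := by
  intro a
  induction hf with
  | subst g hg s => rw [lift_lift_apply]; exact hS g hg _
  | zero => exact map_zero _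
  | add f g _ _ hf hg => rw [map_add, hf, hg, add_zero]
  | smul r f _ hf => rw [map_smul, hf, smul_zero]
  | mul_left h f _ hf => rw [map_mul, hf, mul_zero]
  | mul_right h f _ hf => rw [map_mul, hf, zero_mul]

theorem isIdentityOn_comPoly_plusAlg (A : Type v) [NonUnitalNonAssocRing A] [Module K A]
    [IsScalarTower K A A] [SMulCommClass K A A] : IsIdentityOn K (comPoly K) (PlusAlg A) :=
  (isIdentityOn_comPoly_iff _).2 PlusAlg.mul_comm

theorem FollowsFrom.isNovikovJordanIdentity {f : NAPoly K}
    (hf : FollowsFrom K {comPoly K, tortkenPoly K} f) : IsNovikovJordanIdentity K f := by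
  intro A _ _ _ _ hA
  refine hf.isIdentityOn ?_
  rintro g (rfl | rfl)
  · exact isIdentityOn_comPoly_plusAlg A
  · exact (isIdentityOn_tortkenPoly_iff _).2 hA.isTortken_plusAlg

theorem FollowsFrom.mono {S T : Set (NAPoly K)} (hST : S ⊆ T) {f : NAPoly K}
    (hf : FollowsFrom K S f) : FollowsFrom K T f := by
  induction hf with
  | subst g hg s => exact .subst g (hST hg) s
  | zero => exact .zero
  | add f g _ _ hf hg => exact .add f g hf hg
  | smul r f _ hf => exact .smul r f hf
  | mul_left h f _ hf => exact .mul_left h f hf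
  | mul_right h f _ hf => exact .mul_right h f hf

/-- The Jordan algebra of the `2 × 2` matrices is commutative but not Tortken. -/
theorem not_isTortken_plusAlg_matrix (h2 : (2 : K) ≠ 0) :
    ¬ IsTortken (PlusAlg (Matrix (Fin 2) (Fin 2) K)) := by
  intro h
  -- With a = b = e₁₁, c = e₂₂, d = e₁₂ the left side is 2e₁₂ and the right side is 0.
  have key := h (PlusAlg.mk !![1, 0; 0, 0]) (PlusAlg.mk !![1, 0; 0, 0])
    (PlusAlg.mk !![0, 0; 0, 1]) (PlusAlg.mk !![0, 1; 0, 0])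
  have sub_def : ∀ a b : Matrix (Fin 2) (Fin 2) K,
      PlusAlg.mk a - PlusAlg.mk b = PlusAlg.mk (a - b) := fun _ _ => rfl
  simp only [PlusAlg.mul_def, sub_def] at key
  have := congrFun (congrFun (show (_ : Matrix (Fin 2) (Fin 2) K) = _ from key) 0) 1
  simp [PlusAlg.mk] at this
  norm_num [h2] at this

theorem not_followsFrom_comPoly_tortkenPoly (h2 : (2 : K) ≠ 0) :
    ¬ FollowsFrom K {comPoly K} (tortkenPoly K) := by
  intro h
  refine not_isTortken_plusAlg_matrix h2 ((isIdentityOn_tortkenPoly_iff (K := K) _).1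
    (h.isIdentityOn ?_))
  rintro g rfl
  exact isIdentityOn_comPoly_plusAlg _

end Soundness

/-! ### Relatively free algebras -/

section RelativelyFree

variable {K : Type u} [Field K]

theorem FollowsFrom.neg {S : Set (NAPoly K)} {f : NAPoly K} (hf : FollowsFrom K S f) :
    FollowsFrom K S (-f) := by
  simpa using hf.smul (-1)

/-- Equality modulo the consequences of `S`, as a congruence. -/
def identityCon (S : Set (NAPoly K)) : RingCon (NAPoly K) where
  r f g := FollowsFrom K S (f - g)
  iseqv :=
    { refl := fun f => by rw [sub_self]; exact .zero
      symm := fun h => by simpa using h.neg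
      trans := fun h h' => by simpa using h.add _ _ h' }
  add' h h' := by simpa [add_sub_add_comm] using h.add _ _ h'
  mul' {w x y z} h h' := by
    have := (h.mul_right y _).add _ _ (h'.mul_left x _)
    simpa [sub_mul, mul_sub] using this

/-- The relatively free algebra of the class defined by the identities `S`. -/
abbrev RelFree (S : Set (NAPoly K)) : Type u := (identityCon S).Quotient

variable (S : Set (NAPoly K))

noncomputable instance : NonUnitalNonAssocRing (RelFree S) :=
  { (inferInstance : AddCommGroup (RelFree S)),
    (inferInstance : NonUnitalNonAssocSemiring (RelFree S)) with }

namespace RelFree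

/-- The quotient map to the relatively free algebra. -/
noncomputable def mk (f : NAPoly K) : RelFree S := (f : (identityCon S).Quotient)

variable {S}

theorem mk_surjective : Function.Surjective (mk S) := Quot.mk_surjective

theorem mk_eq_zero {f : NAPoly K} : mk S f = 0 ↔ FollowsFrom K S f := by
  change (f : (identityCon S).Quotient) = ((0 : NAPoly K) : (identityCon S).Quotient) ↔ _
  rw [RingCon.eq]
  change FollowsFrom K S (f - 0) ↔ _
  rw [sub_zero]

theorem mk_add (f g : NAPoly K) : mk S (f + g) = mk S f + mk S g := rfl

theorem mk_mul (f g : NAPoly K) : mk S (f * g) = mk S f * mk S g := rfl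

noncomputable instance : SMul K (RelFree S) where
  smul r := Quotient.map (r • ·) fun f g h => by
    change FollowsFrom K S (r • f - r • g)
    rw [← smul_sub]
    exact .smul r _ h

theorem mk_smul (r : K) (f : NAPoly K) : mk S (r • f) = r • mk S f := rfl

noncomputable instance : Module K (RelFree S) :=
  Function.Surjective.module K ⟨⟨mk S, rfl⟩, mk_add⟩ mk_surjective mk_smul

instance : IsScalarTower K (RelFree S) (RelFree S) where
  smul_assoc r x y := by
    obtain ⟨f, rfl⟩ := mk_surjective x
    obtain ⟨g, rfl⟩ := mk_surjective y
    exact congrArg (mk S) (smul_mul_assoc r f g)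

instance : SMulCommClass K (RelFree S) (RelFree S) where
  smul_comm r x y := by
    obtain ⟨f, rfl⟩ := mk_surjective x
    obtain ⟨g, rfl⟩ := mk_surjective y
    exact congrArg (mk S) (mul_smul_comm r f g).symm

theorem lift_mk (s : ℕ → NAPoly K) (f : NAPoly K) :
    lift K (fun i => mk S (s i)) f = mk S (lift K s f) := by
  let φ : NAPoly K →ₙₐ[K] RelFree S :=
    { toFun := mk S, map_smul' := mk_smul, map_zero' := rfl, map_add' := mk_add,
      map_mul' := mk_mul }
  have : φ.comp (lift K s) = lift K (fun i => mk S (s i)) := hom_ext K fun x => by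
    simp only [NonUnitalAlgHom.comp_apply, lift_of_apply]; rfl
  exact (DFunLike.congr_fun this f).symm

theorem isIdentityOn {g : NAPoly K} (hg : g ∈ S) : IsIdentityOn K g (RelFree S) := by
  intro a
  choose s hs using fun i => mk_surjective (a i)
  obtain rfl : (fun i => mk S (s i)) = a := funext hs
  rw [lift_mk, mk_eq_zero]
  exact .subst g hg s

/-- A polynomial that vanishes at the generators of the relatively free algebra is a
consequence. -/
theorem followsFrom_of_lift_eq_zero {f : NAPoly K}
    (hf : lift K (fun i => mk S (of K i)) f = 0) : FollowsFrom K S f := by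
  rw [lift_mk, mk_eq_zero] at hf
  rwa [show lift K (of K) = NonUnitalAlgHom.id K (NAPoly K) from
    hom_ext K fun x => by rw [lift_of_apply]; rfl] at hf

end RelFree

end RelativelyFree

/-! ### Novikov algebras from derivations -/

/-- The Novikov algebra of a commutative algebra `R` with a derivation `D`: the vector space `R`
with the product `a ∘ b = D a * b`. -/
def DerivAlg {K : Type u} [Field K] {R : Type v} [CommRing R] [Algebra K R]
    (_D : Derivation K R R) : Type v := R

namespace DerivAlg

variable {K : Type u} [Field K] {R : Type v} [CommRing R] [Algebra K R] (D : Derivation K R R)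

instance : AddCommGroup (DerivAlg D) := inferInstanceAs (AddCommGroup R)

instance : Module K (DerivAlg D) := inferInstanceAs (Module K R)

instance : Mul (DerivAlg D) := ⟨fun (a b : R) => (D a * b : R)⟩

instance : NonUnitalNonAssocRing (DerivAlg D) :=
  { (inferInstance : AddCommGroup (DerivAlg D)), (inferInstance : Mul (DerivAlg D)) with
    left_distrib := fun (a b c : R) => mul_add (D a) b c
    right_distrib := fun (a b c : R) => by
      change D (a + b) * c = D a * c + D b * c
      rw [map_add, add_mul]
    zero_mul := fun (a : R) => by
      change D 0 * a = 0
      rw [map_zero, zero_mul]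
    mul_zero := fun (a : R) => mul_zero (D a) }

instance : IsScalarTower K (DerivAlg D) (DerivAlg D) :=
  ⟨fun (r : K) (a b : R) => by
    change D (r • a) * b = r • (D a * b)
    rw [D.map_smul, smul_mul_assoc]⟩

instance : SMulCommClass K (DerivAlg D) (DerivAlg D) :=
  ⟨fun (r : K) (a b : R) => (mul_smul_comm r (D a) b).symm⟩

theorem isNovikov : IsNovikov (DerivAlg D) where
  right_symm := fun (a : R) (b : R) (c : R) => by
    change D a * (D b * c) - D (D a * b) * c = D a * (D c * b) - D (D a * c) * b
    simp only [Derivation.leibniz, smul_eq_mul]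
    ring
  left_comm := fun (a : R) (b : R) (c : R) => by
    change D a * (D b * c) = D b * (D a * c)
    ring

/-- The value of a bracketed word in the Jordan algebra of `DerivAlg D`. -/
def evalWord (x : ℕ → R) : FreeMagma ℕ → R
  | .of i => x i
  | .mul u w => D (evalWord x u * evalWord x w)

end DerivAlg

/-! ### Evaluating bracketed words -/

section Words

variable {K : Type u} [Field K]

/-- A bracketed word as a monomial. -/
noncomputable def wordPoly (K : Type u) [Field K] (w : FreeMagma ℕ) : NAPoly K :=
  MonoidAlgebra.single w 1

theorem wordPoly_of (i : ℕ) : wordPoly K (.of i) = of K i := by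
  simp [wordPoly, of]

theorem wordPoly_mul (u w : FreeMagma ℕ) :
    wordPoly K (.mul u w) = wordPoly K u * wordPoly K w := by
  change MonoidAlgebra.single (u * w) (1 : K) = _
  simp [wordPoly, MonoidAlgebra.single_mul_single]

theorem napoly_eq_sum (f : NAPoly K) :
    f = ∑ w ∈ f.coeff.support, f.coeff w • wordPoly K w := by
  simp only [wordPoly, MonoidAlgebra.smul_single, smul_eq_mul, mul_one]
  exact f.sum_coeff_single.symm

/-- By the Leibniz rule D(a) b + D(b) a = D(ab). -/
theorem lift_wordPoly_derivAlg {R : Type v} [CommRing R] [Algebra K R] (D : Derivation K R R)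
    (x : ℕ → R) (w : FreeMagma ℕ) :
    lift K (A := PlusAlg (DerivAlg D)) x (wordPoly K w) = DerivAlg.evalWord D x w := by
  induction w with
  | ih1 i =>
    change lift K (A := PlusAlg (DerivAlg D)) x (wordPoly K (.of i)) = x i
    rw [wordPoly_of]
    exact lift_of_apply K (A := PlusAlg (DerivAlg D)) x i
  | ih2 u w hu hw =>
    change lift K (A := PlusAlg (DerivAlg D)) x (wordPoly K (.mul u w))
      = D (DerivAlg.evalWord D x u * DerivAlg.evalWord D x w)
    rw [wordPoly_mul, map_mul, hu, hw, D.leibniz, add_comm, smul_eq_mul, smul_eq_mul,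
      mul_comm _ (D (DerivAlg.evalWord D x u)), mul_comm _ (D (DerivAlg.evalWord D x w))]
    rfl

/-- If a linear map on `R` carries the values of the words of `f` in the Jordan algebra of
`DerivAlg D` to multiples of their values in `B`, then a Jordan identity `f` vanishes in `B`. -/
theorem IsNovikovJordanIdentity.lift_eq_zero {f : NAPoly K} (hf : IsNovikovJordanIdentity K f)
    {R : Type u} [CommRing R] [Algebra K R] (D : Derivation K R R) (x : ℕ → R)
    {B : Type v} [NonUnitalNonAssocRing B] [Module K B] [IsScalarTower K B B]
    [SMulCommClass K B B] (b : ℕ → B) (ρ : R →ₗ[K] B) {n : K} (hn : n ≠ 0)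
    (h : ∀ w ∈ f.coeff.support,
      ρ (DerivAlg.evalWord D x w) = n • lift K b (wordPoly K w)) :
    lift K b f = 0 := by
  have h0 : ∑ w ∈ f.coeff.support, f.coeff w • DerivAlg.evalWord D x w = 0 := by
    have := hf (DerivAlg D) (DerivAlg.isNovikov D) x
    rw [napoly_eq_sum f, map_sum] at this
    simp only [map_smul, lift_wordPoly_derivAlg] at this
    exact this
  have h1 : n • lift K b f = 0 := by
    have := congrArg ρ h0
    rw [map_zero, map_sum] at this
    rw [napoly_eq_sum f, map_sum, Finset.smul_sum, ← this]
    refine Finset.sum_congr rfl fun w hw => ?_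
    rw [map_smul, map_smul, h w hw, smul_comm]
  exact (smul_eq_zero.1 h1).resolve_left hn

end Words

/-! ### Linear maps prescribed on monomials -/

section Monomials

variable (K : Type u) [Field K] {σ : Type*} {α : Type*} {B : Type v} [AddCommGroup B] [Module K B]

/-- The linear map that sends the monomial with the variables `F a` to `v a`, and the other
monomials to `0`. -/
noncomputable def monomialMap (F : α → Multiset σ) (v : α → B) : MvPolynomial σ K →ₗ[K] B :=
  (MvPolynomial.basisMonomials σ K).constr K
    fun m => Function.extend F v 0 (Finsupp.toMultiset m)

variable {K}

/-- `Function.extend` chooses a preimage under `F`, so the result is the intended `v a` once `v` is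
known to factor through `F`; this is what the symmetry lemmas are for. -/
theorem monomialMap_prod (F : α → Multiset σ) (v : α → B) (m : Multiset σ) :
    monomialMap K F v (m.map MvPolynomial.X).prod = Function.extend F v 0 m := by
  classical
  have : (m.map MvPolynomial.X).prod
      = MvPolynomial.basisMonomials σ K (Multiset.toFinsupp m) := by
    induction m using Multiset.induction_on with
    | empty => simp
    | cons a m ih =>
      rw [Multiset.map_cons, Multiset.prod_cons, ih, ← Multiset.singleton_add, map_add]
      simp [MvPolynomial.X, MvPolynomial.monomial_mul]
  rw [this, monomialMap, Module.Basis.constr_basis, Multiset.toFinsupp_toMultiset]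

end Monomials

/-! ### Symmetric functions as functions of multisets -/

section SymmetricFunctions

variable {α : Type*} {β : Type*}

theorem eq_of_pair_eq {F : α → α → β} (h : ∀ q r, F q r = F r q) {q r q' r' : α}
    (e : ({q, r} : Multiset α) = {q', r'}) : F q r = F q' r' := by
  have hq : q ∈ ({q', r'} : Multiset α) := e ▸ Multiset.mem_cons_self q _
  simp only [Multiset.insert_eq_cons, Multiset.mem_cons, Multiset.mem_singleton] at hq
  rcases hq with rfl | rfl
  · rw [Multiset.singleton_inj.1 ((Multiset.cons_inj_right q).1 e)]
  · rw [Multiset.pair_comm q' q] at e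
    rw [Multiset.singleton_inj.1 ((Multiset.cons_inj_right q).1 e), h]

/-- The two adjacent transpositions generate all permutations of three arguments. -/
theorem eq_of_triple_eq {F : α → α → α → β} (h₁ : ∀ q r s, F q r s = F r q s)
    (h₂ : ∀ q r s, F q r s = F q s r) {q r s q' r' s' : α}
    (e : ({q, r, s} : Multiset α) = {q', r', s'}) : F q r s = F q' r' s' := by
  have hq : q ∈ ({q', r', s'} : Multiset α) := e ▸ Multiset.mem_cons_self q _
  simp only [Multiset.insert_eq_cons, Multiset.mem_cons, Multiset.mem_singleton] at hq
  rcases hq with rfl | rfl | rfl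
  · exact eq_of_pair_eq (F := F q) (h₂ q) ((Multiset.cons_inj_right q).1 e)
  · rw [h₁ q' q]
    refine eq_of_pair_eq (F := F q) (h₂ q) ((Multiset.cons_inj_right q).1 (e.trans ?_))
    exact Multiset.cons_swap q' q _
  · rw [h₂ q' r', h₁ q' q]
    refine eq_of_pair_eq (F := F q) (h₂ q) ((Multiset.cons_inj_right q).1 (e.trans ?_))
    exact (congrArg (q' ::ₘ ·) (Multiset.pair_comm r' q)).trans (Multiset.cons_swap q' q _)

end SymmetricFunctions

/-! ### Differential polynomials -/

section DifferentialPolynomials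

open MvPolynomial

/-- The derivation of the algebra of differential polynomials; the variable `X (i, j)` is the
`j`-th derivative of the `i`-th indeterminate. -/
noncomputable def diffD (K : Type u) [Field K] :
    Derivation K (MvPolynomial (ℕ × ℕ) K) (MvPolynomial (ℕ × ℕ) K) :=
  mkDerivation K fun i => X (i.1, i.2 + 1)

variable {K : Type u} [Field K]

theorem diffD_X (i j : ℕ) : diffD K (X (i, j)) = X (i, j + 1) := mkDerivation_X _ _ _

theorem diffD_mul (f g : MvPolynomial (ℕ × ℕ) K) :
    diffD K (f * g) = diffD K f * g + f * diffD K g := by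
  rw [Derivation.leibniz, smul_eq_mul, smul_eq_mul]
  ring

/-- The indeterminates whose `n`-th derivatives occur in a monomial. -/
def derivLevel (n : ℕ) (m : Multiset (ℕ × ℕ)) : Multiset ℕ :=
  (m.filter (·.2 = n)).map Prod.fst

/-- The term with coefficient two is written twice, so that additivity alone suffices when a linear
map is applied. -/
theorem diffD_word₃ (i j k : ℕ) :
    diffD K (X (i, 0) * diffD K (X (j, 0) * X (k, 0))) =
      X (i, 1) * X (j, 1) * X (k, 0) + X (i, 1) * X (k, 1) * X (j, 0)
        + X (j, 2) * X (i, 0) * X (k, 0) + X (j, 1) * X (k, 1) * X (i, 0)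
        + X (j, 1) * X (k, 1) * X (i, 0) + X (k, 2) * X (i, 0) * X (j, 0) := by
  simp only [diffD_mul, diffD_X, map_add]
  ring

variable {B : Type v} [NonUnitalNonAssocRing B] [Module K B]

theorem monomialMap_X {α : Type*} (F : α → Multiset (ℕ × ℕ)) (v : α → B) (i : ℕ × ℕ) :
    monomialMap K F v (X i) = Function.extend F v 0 {i} := by
  rw [← monomialMap_prod (K := K)]
  simp

theorem monomialMap_X₂ {α : Type*} (F : α → Multiset (ℕ × ℕ)) (v : α → B) (i j : ℕ × ℕ) :
    monomialMap K F v (X i * X j) = Function.extend F v 0 {i, j} := by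
  rw [← monomialMap_prod (K := K)]
  simp

theorem monomialMap_X₃ {α : Type*} (F : α → Multiset (ℕ × ℕ)) (v : α → B) (i j k : ℕ × ℕ) :
    monomialMap K F v (X i * X j * X k) = Function.extend F v 0 {i, j, k} := by
  rw [← monomialMap_prod (K := K)]
  simp [mul_assoc]

theorem monomialMap_X₄ {α : Type*} (F : α → Multiset (ℕ × ℕ)) (v : α → B) (i j k l : ℕ × ℕ) :
    monomialMap K F v (X i * X j * X k * X l) = Function.extend F v 0 {i, j, k, l} := by
  rw [← monomialMap_prod (K := K)]
  simp [mul_assoc]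

/-- The pieces of a recovery map live on monomials with different multisets of derivation orders.
These multisets are explicit numerals, so `decide` separates them. -/
theorem extend_eq_zero {α : Type*} {F : α → Multiset (ℕ × ℕ)} {v : α → B} {m : Multiset (ℕ × ℕ)}
    (h : ∀ a, (F a).map Prod.snd ≠ m.map Prod.snd) : Function.extend F v 0 m = 0 :=
  Function.extend_apply' _ _ _ (by rintro ⟨a, rfl⟩; exact h a rfl)

/-! ### Recovering words of length at most three -/

section DegreeThree

/-- The monomial `x_p`. -/
def mono₁ (p : ℕ) : Multiset (ℕ × ℕ) := {(p, 0)}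

/-- The monomial `x_p' x_q`. -/
def mono₂ (p : ℕ × ℕ) : Multiset (ℕ × ℕ) := {(p.1, 1), (p.2, 0)}

/-- The monomial `x_p'' x_q x_r`. -/
def mono₃ (p : ℕ × ℕ × ℕ) : Multiset (ℕ × ℕ) := {(p.1, 2), (p.2.1, 0), (p.2.2, 0)}

/-- A linear map that recovers the words of length at most `3` in a commutative algebra from
their values in differential polynomials. -/
noncomputable def recover₃ (K : Type u) [Field K] [Module K B] (b : ℕ → B) :
    MvPolynomial (ℕ × ℕ) K →ₗ[K] B :=
  monomialMap K mono₁ (fun p => (2 : K) • b p) +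
  monomialMap K mono₂ (fun p => b p.1 * b p.2) +
  monomialMap K mono₃ (fun p => b p.2.1 * (b p.1 * b p.2.2) + b p.2.2 * (b p.1 * b p.2.1)
    - b p.1 * (b p.2.1 * b p.2.2))

variable (b : ℕ → B)

/-- The factor 2 matches the scale in lengths two and three, so that inhomogeneous polynomials can
be treated at once. -/
theorem recover₃_X (p : ℕ) : recover₃ K b (X (p, 0)) = (2 : K) • b p := by
  have h₁ : Function.FactorsThrough (fun p => (2 : K) • b p) mono₁ := by
    intro p q h
    have : p = q := by simpa [mono₁] using h
    rw [this]
  simp only [recover₃, LinearMap.add_apply, monomialMap_X]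
  rw [show ({(p, 0)} : Multiset (ℕ × ℕ)) = mono₁ p from rfl, h₁.extend_apply,
    extend_eq_zero, extend_eq_zero, add_zero, add_zero] <;>
  · intro a
    simp only [mono₁, mono₂, mono₃, Multiset.insert_eq_cons, Multiset.map_cons,
      Multiset.map_singleton]
    decide

theorem recover₃_X₂ (p q : ℕ) : recover₃ K b (X (p, 1) * X (q, 0)) = b p * b q := by
  have h₂ : Function.FactorsThrough (fun p : ℕ × ℕ => b p.1 * b p.2) mono₂ := by
    rintro ⟨p, q⟩ ⟨p', q'⟩ h
    -- Sorting the factors by order of derivation reads the indices off the monomial.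
    have h0 := congrArg (derivLevel 0) h
    have h1 := congrArg (derivLevel 1) h
    simp [mono₂, derivLevel, Multiset.filter_singleton] at h0 h1
    rw [h0, h1]
  simp only [recover₃, LinearMap.add_apply, monomialMap_X₂]
  rw [show ({(p, 1), (q, 0)} : Multiset (ℕ × ℕ)) = mono₂ (p, q) from rfl, h₂.extend_apply,
    extend_eq_zero, extend_eq_zero, add_zero, zero_add] <;>
  · intro a
    simp only [mono₁, mono₂, mono₃, Multiset.insert_eq_cons, Multiset.map_cons,
      Multiset.map_singleton]
    decide

theorem recover₃_X₃ (hc : ∀ x y : B, x * y = y * x) (p q r : ℕ) :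
    recover₃ K b (X (p, 2) * X (q, 0) * X (r, 0)) =
      b q * (b p * b r) + b r * (b p * b q) - b p * (b q * b r) := by
  have h₃ : Function.FactorsThrough (fun p : ℕ × ℕ × ℕ => b p.2.1 * (b p.1 * b p.2.2)
      + b p.2.2 * (b p.1 * b p.2.1) - b p.1 * (b p.2.1 * b p.2.2)) mono₃ := by
    rintro ⟨p, q, r⟩ ⟨p', q', r'⟩ h
    have h0 := congrArg (derivLevel 0) h
    have h1 := congrArg (derivLevel 2) h
    simp [mono₃, derivLevel, Multiset.filter_singleton] at h0 h1
    subst h1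
    refine eq_of_pair_eq (F := fun q r =>
      b q * (b p * b r) + b r * (b p * b q) - b p * (b q * b r)) (fun q r => ?_) h0
    simp only [hc (b r) (b q)]
    abel
  simp only [recover₃, LinearMap.add_apply, monomialMap_X₃]
  rw [show ({(p, 2), (q, 0), (r, 0)} : Multiset (ℕ × ℕ)) = mono₃ (p, q, r) from rfl,
    h₃.extend_apply, extend_eq_zero, extend_eq_zero, zero_add, zero_add] <;>
  · intro a
    simp only [mono₁, mono₂, mono₃, Multiset.insert_eq_cons, Multiset.map_cons,
      Multiset.map_singleton]
    decide

theorem recover₃_X₃_eq_zero (p q r : ℕ) :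
    recover₃ K b (X (p, 1) * X (q, 1) * X (r, 0)) = 0 := by
  simp only [recover₃, LinearMap.add_apply, monomialMap_X₃]
  rw [extend_eq_zero, extend_eq_zero, extend_eq_zero, add_zero, add_zero] <;>
  · intro a
    simp only [mono₁, mono₂, mono₃, Multiset.insert_eq_cons, Multiset.map_cons,
      Multiset.map_singleton]
    decide

/-- Only x_j'' x_i x_k and x_k'' x_i x_j survive; in the sum of their images everything cancels
except two copies of b_i(b_j b_k). -/
theorem recover₃_word₃ (hc : ∀ x y : B, x * y = y * x) (i j k : ℕ) :
    recover₃ K b (diffD K (X (i, 0) * diffD K (X (j, 0) * X (k, 0)))) =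
      (2 : K) • (b i * (b j * b k)) := by
  simp only [diffD_word₃, map_add, recover₃_X₃_eq_zero, recover₃_X₃ b hc]
  rw [hc (b k) (b j), hc (b k) (b i), hc (b j) (b i)]
  module

theorem recover₃_evalWord [IsScalarTower K B B] [SMulCommClass K B B]
    (hc : ∀ x y : B, x * y = y * x) (w : FreeMagma ℕ) (hw : w.length ≤ 3) :
    recover₃ K b (DerivAlg.evalWord (diffD K) (fun i => X (i, 0)) w) =
      (2 : K) • lift K b (wordPoly K w) := by
  have pos := @FreeMagma.length_pos ℕ
  match w with
  | .of i => simpa [DerivAlg.evalWord, wordPoly_of] using recover₃_X b i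
  | .mul (.of i) (.of j) =>
    simp only [DerivAlg.evalWord, wordPoly_mul, wordPoly_of, map_mul, lift_of_apply, diffD_mul,
      diffD_X, map_add, zero_add]
    rw [mul_comm (X (i, 0)), recover₃_X₂, recover₃_X₂, hc (b j)]
    module
  | .mul (.of i) (.mul (.of j) (.of k)) =>
    simpa only [DerivAlg.evalWord, wordPoly_mul, wordPoly_of, map_mul, lift_of_apply]
      using recover₃_word₃ b hc i j k
  | .mul (.mul (.of j) (.of k)) (.of i) =>
    simp only [DerivAlg.evalWord, wordPoly_mul, wordPoly_of, map_mul, lift_of_apply]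
    rw [mul_comm, hc]
    exact recover₃_word₃ b hc i j k
  -- The remaining patterns have at least four leaves, because every subtree has positive length.
  | .mul (.mul u v) (.mul s t) =>
    have := pos u; have := pos v; have := pos s; have := pos t
    simp only [FreeMagma.length] at hw
    omega
  | .mul (.of _) (.mul (.mul u v) s) =>
    have := pos u; have := pos v; have := pos s
    simp only [FreeMagma.length] at hw
    omega
  | .mul (.of _) (.mul (.of _) (.mul u v)) =>
    have := pos u; have := pos v
    simp only [FreeMagma.length] at hw
    omega
  | .mul (.mul (.mul u v) s) (.of _) =>
    have := pos u; have := pos v; have := pos s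
    simp only [FreeMagma.length] at hw
    omega
  | .mul (.mul (.of _) (.mul u v)) (.of _) =>
    have := pos u; have := pos v
    simp only [FreeMagma.length] at hw
    omega

end DegreeThree

end DifferentialPolynomials

/-! ### Symmetric elements of degree four in commutative Tortken algebras -/

section TortkenElements

variable {B : Type v} [NonUnitalNonAssocRing B]

/-- The element of a commutative Tortken algebra that corresponds to `4 p' q' r s`, where the
product is `(f, g) ↦ (f g)'` and the outermost derivation is dropped. -/
def tortkenY (p q r s : B) : B :=
  (p * r) * (q * s) + (p * s) * (q * r) - (p * q) * (r * s)
    + r * (p * (q * s)) - p * (r * (q * s)) + s * (q * (p * r)) - q * (s * (p * r))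

/-- The element of a commutative Tortken algebra that corresponds to `4 p'' q r s`, where the
product is `(f, g) ↦ (f g)'` and the outermost derivation is dropped. -/
def tortkenZ (p q r s : B) : B :=
  2 • (r * (s * (p * q))) + 2 • (q * (s * (p * r))) - 2 • (p * (s * (q * r)))
    - tortkenY p s q r - tortkenY p q r s - tortkenY p r q s + tortkenY q r p s

/-- Commutativity reduces every product of four elements to the shape (xy)(zw) or x(y(zw)); this is
the Tortken identity in these shapes. -/
theorem IsTortken.eq_zero (hT : IsTortken B) (hc : ∀ x y : B, x * y = y * x) (a b c d : B) :
    (a * b) * (c * d) - (a * d) * (c * b) - d * (a * (b * c)) + d * (c * (a * b))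
      + b * (a * (d * c)) - b * (c * (a * d)) = 0 := by
  have h := sub_eq_zero.2 (hT a b c d)
  rw [← h, sub_mul, sub_mul, hc (a * (b * c)) d, hc (a * b * c) d, hc (a * b) c,
    hc (a * (d * c)) b, hc (a * d * c) b, hc (a * d) c]
  abel

theorem tortkenY_comm₃₄ (hT : IsTortken B) (hc : ∀ x y : B, x * y = y * x) (p q r s : B) :
    tortkenY p q r s = tortkenY p q s r := by
  have T := hT.eq_zero hc
  linear_combination (norm := skip) T p r q s - T r p s q
  -- As `hc` is a permutation of variables, `simp` uses it only to sort factors, which brings equal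
  -- products to one normal form.
  simp only [tortkenY, hc]
  module

theorem tortkenY_comm₁₂ (hT : IsTortken B) (hc : ∀ x y : B, x * y = y * x) (p q r s : B) :
    tortkenY p q r s = tortkenY q p r s := by
  have T := hT.eq_zero hc
  linear_combination (norm := skip) T p r q s - T r p s q
  simp only [tortkenY, hc]
  module

theorem tortkenZ_comm₂₃ (hT : IsTortken B) (hc : ∀ x y : B, x * y = y * x) (p q r s : B) :
    tortkenZ p q r s = tortkenZ p r q s := by
  have T := hT.eq_zero hc
  linear_combination (norm := skip) 2 • T q p r s - 2 • T p q s r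
  simp only [tortkenZ, tortkenY, hc]
  module

theorem tortkenZ_comm₃₄ (hT : IsTortken B) (hc : ∀ x y : B, x * y = y * x) (p q r s : B) :
    tortkenZ p q r s = tortkenZ p q s r := by
  have T := hT.eq_zero hc
  linear_combination (norm := skip) 3 • T r p s q - T p r q s
  simp only [tortkenZ, tortkenY, hc]
  module

/-- This mirrors the four terms of (pq)'(rs)'. -/
theorem four_smul_mul_mul (hc : ∀ x y : B, x * y = y * x) (p q r s : B) :
    tortkenY p r q s + tortkenY p s q r + tortkenY q r p s + tortkenY q s p r
      = 4 • ((p * q) * (r * s)) := by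
  simp only [tortkenY, hc]
  module

/-- This mirrors the expansion of p(q(rs)')', in which r's'pq occurs twice. -/
theorem four_smul_mul_mul_mul (hT : IsTortken B) (hc : ∀ x y : B, x * y = y * x) (p q r s : B) :
    tortkenZ r p q s + tortkenZ s p q r + tortkenY q r p s + tortkenY q s p r
        + 2 • tortkenY r s p q
      = 4 • (p * (q * (r * s))) := by
  have T := hT.eq_zero hc
  linear_combination (norm := skip) -(2 • T p q s r) - 2 • T p r q s - 2 • T q p r s
  simp only [tortkenZ, tortkenY, hc]
  module

end TortkenElements

/-! ### Recovering words of length four -/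

section DegreeFour

open MvPolynomial

variable {K : Type u} [Field K] {B : Type v} [NonUnitalNonAssocRing B] [Module K B] (b : ℕ → B)

/-- The monomial `x_p'' x_q' x_r x_s`. -/
def mono₂₁ (p : ℕ × ℕ × ℕ × ℕ) : Multiset (ℕ × ℕ) :=
  {(p.1, 2), (p.2.1, 1), (p.2.2.1, 0), (p.2.2.2, 0)}

/-- The monomial `x_p''' x_q x_r x_s`. -/
def mono₄ (p : ℕ × ℕ × ℕ × ℕ) : Multiset (ℕ × ℕ) :=
  {(p.1, 3), (p.2.1, 0), (p.2.2.1, 0), (p.2.2.2, 0)}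

/-- The value of `recover₄` at `x_p''' x_q x_r x_s`. -/
def tortkenU (p q r s : B) : B :=
  2 • tortkenZ p q r s - tortkenY p q r s - tortkenY p r q s - tortkenY p s q r

theorem tortkenU_comm₂₃ (hT : IsTortken B) (hc : ∀ x y : B, x * y = y * x) (p q r s : B) :
    tortkenU p q r s = tortkenU p r q s := by
  rw [tortkenU, tortkenU, tortkenZ_comm₂₃ hT hc, tortkenY_comm₃₄ hT hc p s q r]
  abel

theorem tortkenU_comm₃₄ (hT : IsTortken B) (hc : ∀ x y : B, x * y = y * x) (p q r s : B) :
    tortkenU p q r s = tortkenU p q s r := by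
  rw [tortkenU, tortkenU, tortkenZ_comm₃₄ hT hc, tortkenY_comm₃₄ hT hc p q r s]
  abel

/-- A linear map that recovers the words of length `4` in a commutative Tortken algebra from
their values in differential polynomials. -/
noncomputable def recover₄ (K : Type u) [Field K] [Module K B] (b : ℕ → B) :
    MvPolynomial (ℕ × ℕ) K →ₗ[K] B :=
  monomialMap K mono₂₁ (fun p => tortkenY (b p.1) (b p.2.1) (b p.2.2.1) (b p.2.2.2)) +
  monomialMap K mono₄ (fun p => tortkenU (b p.1) (b p.2.1) (b p.2.2.1) (b p.2.2.2))

theorem recover₄_X₂₁ (hT : IsTortken B) (hc : ∀ x y : B, x * y = y * x) (p q r s : ℕ) :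
    recover₄ K b (X (p, 2) * X (q, 1) * X (r, 0) * X (s, 0)) =
      tortkenY (b p) (b q) (b r) (b s) := by
  have h : Function.FactorsThrough
      (fun p : ℕ × ℕ × ℕ × ℕ => tortkenY (b p.1) (b p.2.1) (b p.2.2.1) (b p.2.2.2)) mono₂₁ := by
    rintro ⟨p, q, r, s⟩ ⟨p', q', r', s'⟩ h
    have h0 := congrArg (derivLevel 0) h
    have h1 := congrArg (derivLevel 1) h
    have h2 := congrArg (derivLevel 2) h
    simp [mono₂₁, derivLevel, Multiset.filter_singleton] at h0 h1 h2
    subst h1 h2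
    exact eq_of_pair_eq (F := fun r s => tortkenY (b p) (b q) (b r) (b s))
      (fun r s => tortkenY_comm₃₄ hT hc _ _ _ _) h0
  simp only [recover₄, LinearMap.add_apply, monomialMap_X₄]
  rw [show ({(p, 2), (q, 1), (r, 0), (s, 0)} : Multiset (ℕ × ℕ)) = mono₂₁ (p, q, r, s) from rfl,
    h.extend_apply, extend_eq_zero, add_zero]
  intro a
  simp only [mono₂₁, mono₄, Multiset.insert_eq_cons, Multiset.map_cons, Multiset.map_singleton]
  decide

theorem recover₄_X₄ (hT : IsTortken B) (hc : ∀ x y : B, x * y = y * x) (p q r s : ℕ) :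
    recover₄ K b (X (p, 3) * X (q, 0) * X (r, 0) * X (s, 0)) =
      tortkenU (b p) (b q) (b r) (b s) := by
  have h : Function.FactorsThrough
      (fun p : ℕ × ℕ × ℕ × ℕ => tortkenU (b p.1) (b p.2.1) (b p.2.2.1) (b p.2.2.2)) mono₄ := by
    rintro ⟨p, q, r, s⟩ ⟨p', q', r', s'⟩ h
    have h0 := congrArg (derivLevel 0) h
    have h3 := congrArg (derivLevel 3) h
    simp [mono₄, derivLevel, Multiset.filter_singleton] at h0 h3
    subst h3
    exact eq_of_triple_eq (F := fun q r s => tortkenU (b p) (b q) (b r) (b s))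
      (fun q r s => tortkenU_comm₂₃ hT hc _ _ _ _) (fun q r s => tortkenU_comm₃₄ hT hc _ _ _ _) h0
  simp only [recover₄, LinearMap.add_apply, monomialMap_X₄]
  rw [show ({(p, 3), (q, 0), (r, 0), (s, 0)} : Multiset (ℕ × ℕ)) = mono₄ (p, q, r, s) from rfl,
    h.extend_apply, extend_eq_zero, zero_add]
  intro a
  simp only [mono₂₁, mono₄, Multiset.insert_eq_cons, Multiset.map_cons, Multiset.map_singleton]
  decide

/-- These monomials can be discarded: the other terms of D(p'q'rs) already determine `tortkenY`. -/
theorem recover₄_X₄_eq_zero (p q r s : ℕ) :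
    recover₄ K b (X (p, 1) * X (q, 1) * X (r, 1) * X (s, 0)) = 0 := by
  simp only [recover₄, LinearMap.add_apply, monomialMap_X₄]
  rw [extend_eq_zero, extend_eq_zero, add_zero] <;>
  · intro a
    simp only [mono₂₁, mono₄, Multiset.insert_eq_cons, Multiset.map_cons, Multiset.map_singleton]
    decide

/-- The Y-terms subtracted in `tortkenU` cancel the images of p''q'rs, p''r'qs and p''s'qr. -/
theorem recover₄_diffD_Z (hT : IsTortken B) (hc : ∀ x y : B, x * y = y * x) (p q r s : ℕ) :
    recover₄ K b (diffD K (X (p, 2) * X (q, 0) * X (r, 0) * X (s, 0))) =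
      2 • tortkenZ (b p) (b q) (b r) (b s) := by
  have : diffD K (X (p, 2) * X (q, 0) * X (r, 0) * X (s, 0)) =
      X (p, 3) * X (q, 0) * X (r, 0) * X (s, 0) + X (p, 2) * X (q, 1) * X (r, 0) * X (s, 0)
        + X (p, 2) * X (r, 1) * X (q, 0) * X (s, 0)
        + X (p, 2) * X (s, 1) * X (q, 0) * X (r, 0) := by
    simp only [diffD_mul, diffD_X]
    ring
  simp only [this, map_add, recover₄_X₂₁ b hT hc, recover₄_X₄ b hT hc, tortkenU]
  abel

/-- The images of p''q'rs and q''p'rs agree by the symmetry of `tortkenY` in its first two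
arguments. -/
theorem recover₄_diffD_Y (hT : IsTortken B) (hc : ∀ x y : B, x * y = y * x) (p q r s : ℕ) :
    recover₄ K b (diffD K (X (p, 1) * X (q, 1) * X (r, 0) * X (s, 0))) =
      2 • tortkenY (b p) (b q) (b r) (b s) := by
  have : diffD K (X (p, 1) * X (q, 1) * X (r, 0) * X (s, 0)) =
      X (p, 2) * X (q, 1) * X (r, 0) * X (s, 0) + X (q, 2) * X (p, 1) * X (r, 0) * X (s, 0)
        + X (p, 1) * X (q, 1) * X (r, 1) * X (s, 0)
        + X (p, 1) * X (q, 1) * X (s, 1) * X (r, 0) := by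
    simp only [diffD_mul, diffD_X]
    ring
  simp only [this, map_add, recover₄_X₂₁ b hT hc, recover₄_X₄_eq_zero,
    tortkenY_comm₁₂ hT hc (b q) (b p)]
  abel

/-- The scale 8 is the 4 built into `tortkenY` and `tortkenZ` times the 2 that comes from undoing
the outermost D. -/
theorem recover₄_word₂₂ (hT : IsTortken B) (hc : ∀ x y : B, x * y = y * x) (i j k l : ℕ) :
    recover₄ K b (diffD K (diffD K (X (i, 0) * X (j, 0)) * diffD K (X (k, 0) * X (l, 0)))) =
      (8 : K) • ((b i * b j) * (b k * b l)) := by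
  have : diffD K (X (i, 0) * X (j, 0)) * diffD K (X (k, 0) * X (l, 0)) =
      X (i, 1) * X (k, 1) * X (j, 0) * X (l, 0) + X (i, 1) * X (l, 1) * X (j, 0) * X (k, 0)
        + X (j, 1) * X (k, 1) * X (i, 0) * X (l, 0)
        + X (j, 1) * X (l, 1) * X (i, 0) * X (k, 0) := by
    simp only [diffD_mul, diffD_X]
    ring
  simp only [this, map_add, recover₄_diffD_Y b hT hc, ← smul_add]
  rw [four_smul_mul_mul hc]
  module

theorem recover₄_word₄ (hT : IsTortken B) (hc : ∀ x y : B, x * y = y * x) (i j k l : ℕ) :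
    recover₄ K b (diffD K (X (i, 0) * diffD K (X (j, 0) * diffD K (X (k, 0) * X (l, 0))))) =
      (8 : K) • (b i * (b j * (b k * b l))) := by
  have : X (i, 0) * diffD K (X (j, 0) * diffD K (X (k, 0) * X (l, 0))) =
      X (k, 2) * X (i, 0) * X (j, 0) * X (l, 0) + X (l, 2) * X (i, 0) * X (j, 0) * X (k, 0)
        + X (j, 1) * X (k, 1) * X (i, 0) * X (l, 0) + X (j, 1) * X (l, 1) * X (i, 0) * X (k, 0)
        + (X (k, 1) * X (l, 1) * X (i, 0) * X (j, 0)
          + X (k, 1) * X (l, 1) * X (i, 0) * X (j, 0)) := by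
    rw [diffD_word₃]
    ring
  simp only [this, map_add, recover₄_diffD_Y b hT hc, recover₄_diffD_Z b hT hc]
  have key := four_smul_mul_mul_mul hT hc (b i) (b j) (b k) (b l)
  linear_combination (norm := module) (2 : K) • key

theorem recover₄_evalWord [IsScalarTower K B B] [SMulCommClass K B B] (hT : IsTortken B)
    (hc : ∀ x y : B, x * y = y * x) (w : FreeMagma ℕ) (hw : w.length = 4) :
    recover₄ K b (DerivAlg.evalWord (diffD K) (fun i => X (i, 0)) w) =
      (8 : K) • lift K b (wordPoly K w) := by
  have pos := @FreeMagma.length_pos ℕ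
  match w with
  | .of i => simp [FreeMagma.length] at hw
  | .mul (.of i) (.of j) => simp [FreeMagma.length] at hw
  | .mul (.of i) (.mul (.of j) (.of k)) => simp [FreeMagma.length] at hw
  | .mul (.mul (.of j) (.of k)) (.of i) => simp [FreeMagma.length] at hw
  | .mul (.mul (.of i) (.of j)) (.mul (.of k) (.of l)) =>
    simp only [DerivAlg.evalWord, wordPoly_mul, wordPoly_of, map_mul, lift_of_apply]
    exact recover₄_word₂₂ b hT hc i j k l
  | .mul (.of i) (.mul (.of j) (.mul (.of k) (.of l))) =>
    simp only [DerivAlg.evalWord, wordPoly_mul, wordPoly_of, map_mul, lift_of_apply]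
    exact recover₄_word₄ b hT hc i j k l
  | .mul (.of i) (.mul (.mul (.of k) (.of l)) (.of j)) =>
    simp only [DerivAlg.evalWord, wordPoly_mul, wordPoly_of, map_mul, lift_of_apply]
    rw [mul_comm _ (X (j, 0)), hc _ (b j)]
    exact recover₄_word₄ b hT hc i j k l
  | .mul (.mul (.of j) (.mul (.of k) (.of l))) (.of i) =>
    simp only [DerivAlg.evalWord, wordPoly_mul, wordPoly_of, map_mul, lift_of_apply]
    rw [mul_comm _ (X (i, 0)), hc _ (b i)]
    exact recover₄_word₄ b hT hc i j k l
  | .mul (.mul (.mul (.of k) (.of l)) (.of j)) (.of i) =>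
    simp only [DerivAlg.evalWord, wordPoly_mul, wordPoly_of, map_mul, lift_of_apply]
    rw [mul_comm _ (X (i, 0)), mul_comm _ (X (j, 0)), hc _ (b i), hc _ (b j)]
    exact recover₄_word₄ b hT hc i j k l
  -- The five tree shapes with four leaves are done; each pattern from here on has five subtrees,
  -- hence length at least five.
  | .mul (.mul (.mul s t) u) (.mul v x)
  | .mul (.mul s (.mul t u)) (.mul v x)
  | .mul (.mul s t) (.mul (.mul u v) x)
  | .mul (.mul s t) (.mul u (.mul v x))
  | .mul s (.mul (.mul t u) (.mul v x))
  | .mul s (.mul t (.mul (.mul u v) x))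
  | .mul s (.mul t (.mul u (.mul v x)))
  | .mul s (.mul (.mul (.mul t u) v) x)
  | .mul s (.mul (.mul t (.mul u v)) x)
  | .mul (.mul (.mul s t) (.mul u v)) x
  | .mul (.mul s (.mul (.mul t u) v)) x
  | .mul (.mul s (.mul t (.mul u v))) x
  | .mul (.mul (.mul (.mul s t) u) v) x
  | .mul (.mul (.mul s (.mul t u)) v) x =>
    have := pos s; have := pos t; have := pos u; have := pos v; have := pos x
    simp only [FreeMagma.length] at hw
    omega

end DegreeFour

/-! ### Conclusion -/

section Main

variable {K : Type u} [Field K]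

theorem card_letters (w : FreeMagma ℕ) : (letters w).card = w.length := by
  induction w with
  | ih1 i => rfl
  | ih2 u v hu hv =>
    change (letters u + letters v).card = u.length + v.length
    rw [Multiset.card_add, hu, hv]

theorem RelFree.mul_comm {S : Set (NAPoly K)} (hS : comPoly K ∈ S) (x y : RelFree S) :
    x * y = y * x :=
  (isIdentityOn_comPoly_iff _).1 (RelFree.isIdentityOn hS) x y

theorem RelFree.isTortken {S : Set (NAPoly K)} (hS : tortkenPoly K ∈ S) : IsTortken (RelFree S) :=
  (isIdentityOn_tortkenPoly_iff _).1 (RelFree.isIdentityOn hS)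

theorem IsNovikovJordanIdentity.followsFrom_comPoly (h2 : (2 : K) ≠ 0) {f : NAPoly K}
    (hf : IsNovikovJordanIdentity K f) (hdeg : DegreeLE 3 f) : FollowsFrom K {comPoly K} f :=
  RelFree.followsFrom_of_lift_eq_zero <| hf.lift_eq_zero (diffD K) _ _ (recover₃ K _) h2
    fun w hw => recover₃_evalWord _ (RelFree.mul_comm (Set.mem_singleton _)) w (hdeg w hw)

/-- Homogeneous identities of degree `4` follow from commutativity and the Tortken identity. -/
theorem IsNovikovJordanIdentity.followsFrom_comPoly_tortkenPoly (h2 : (2 : K) ≠ 0) {f : NAPoly K}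
    (hf : IsNovikovJordanIdentity K f) (hdeg : ∀ w ∈ f.coeff.support, w.length = 4) :
    FollowsFrom K {comPoly K, tortkenPoly K} f := by
  have h8 : (8 : K) ≠ 0 := by
    rw [show (8 : K) = 2 ^ 3 by norm_num]
    exact pow_ne_zero 3 h2
  exact RelFree.followsFrom_of_lift_eq_zero <| hf.lift_eq_zero (diffD K) _ _ (recover₄ K _) h8
    fun w hw => recover₄_evalWord _ (RelFree.isTortken (by simp)) (RelFree.mul_comm (by simp)) w
      (hdeg w hw)

end Main

theorem mainTheorem1 (K : Type u) [Field K] :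
    -- for every Novikov algebra `A` over `K`, the algebra `A⁺` is Tortken
    (∀ (A : Type v) [NonUnitalNonAssocRing A] [Module K A] [IsScalarTower K A A]
      [SMulCommClass K A A], IsNovikov A → IsTortken (PlusAlg A)) ∧
    -- in characteristic `≠ 2` the Tortken identity is the Jordan identity of the class
    (ringChar K ≠ 2 →
      -- it does not follow from commutativity
      ¬ FollowsFrom K {comPoly K} (tortkenPoly K) ∧
      -- identities of degree at most `3` are the consequences of commutativity
      (∀ f : NAPoly K, DegreeLE 3 f →
        (IsNovikovJordanIdentity K f ↔ FollowsFrom K {comPoly K} f)) ∧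
      -- multilinear identities of degree `4` are the consequences of commutativity and Tortken
      (∀ f : NAPoly K, IsMultilinearPoly 4 f →
        (IsNovikovJordanIdentity K f ↔ FollowsFrom K {comPoly K, tortkenPoly K} f))) := by
  refine ⟨fun A _ _ _ _ hA => hA.isTortken_plusAlg, fun hK => ?_⟩
  have h2 : (2 : K) ≠ 0 := Ring.two_ne_zero hK
  refine ⟨not_followsFrom_comPoly_tortkenPoly h2, fun f hf => ⟨fun h => ?_, fun h => ?_⟩,
    fun f hf => ⟨fun h => ?_, fun h => h.isNovikovJordanIdentity⟩⟩
  · exact h.followsFrom_comPoly h2 hf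
  · exact (h.mono (Set.singleton_subset_iff.2 (Set.mem_insert _ _))).isNovikovJordanIdentity
  -- Of multilinearity only homogeneity of degree four is needed.
  · refine h.followsFrom_comPoly_tortkenPoly h2 fun w hw => ?_
    rw [← card_letters, hf w hw, Multiset.card_range]
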